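/- For a finite simple graph $G$ on $n$ vertices let $I(G,z)=\sum_{k=0}^{n}(-1)^k a_k(G)z^k$ be its independence polynomial, where $a_k(G)$ is the number of independent sets of $G$ of size $k$. There is an absolute constant $c\in\mathbb{N}$ such that for every $n\ge 1$ and every connected simple graph $G$ on $n$ vertices, the polynomial $I(G,z)$ has a smallest real root $\beta(G)$, and the open disc $$D\!\left(0,\ \beta(G)+\left(\frac{\beta(G)}{n}\right)^{c\,n}\right)\subset\mathbb{C}$$ contains $\beta(G)$ and no other complex root of $I(G,z)$. -/

import Mathlib

open Polynomial

universe u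

namespace SimpleGraph

variable {V : Type u} [Fintype V]

/-- `a_k(G)`: the number of independent sets of size `k` of the graph `G`. -/
noncomputable def numIndepSets (G : SimpleGraph V) (k : ℕ) : ℕ :=
  {s : Finset V | G.IsNIndepSet k s}.ncard

/-- The independence polynomial `I(G, z) = ∑_{k=0}^n (-1)^k a_k(G) z^k` of a graph on `n` vertices,
with the alternating sign convention. -/
noncomputable def indepPoly (G : SimpleGraph V) : ℤ[X] :=
  ∑ k ∈ Finset.range (Fintype.card V + 1), C ((-1) ^ k * (G.numIndepSets k : ℤ)) * X ^ k

/-- `β(G)`: the smallest real root of the independence polynomial (the infimum of the finite set of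
its real roots). -/
noncomputable def smallestRoot (G : SimpleGraph V) : ℝ :=
  sInf {x : ℝ | aeval x G.indepPoly = 0}

end SimpleGraph

/-! Write I(A, z) for the independence sum over subsets of A. Deleting a vertex v gives I(A) = I(A -
v) - z I(A - N[v]). Hence for B ⊆ A the ratio I(B)/I(A) behaves like a power series with nonnegative
coefficients: as long as all subsets of A have positive sums at r, its values on |z| ≤ r are
dominated by its value at r (`indepSum_ratio_aux`). Fix v and put F = I(V - N[v])/I(V - v), so that
roots of I(V) near β solve z F(z) = 1. Domination excludes |z| < β. For n ≥ 2, v has a neighbour, so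
F contains the term z, and a root off the positive axis loses in the triangle inequality for 1 + z
an amount of order |z - |z||². This forces I(V, |z|) to be clearly negative
(`indepSum_add_le_zero_of_root`), whereas |z| close to β makes it nearly zero. Connectedness makes
this quantitative: I(B, β) ≥ β^n for every B missing a vertex (`Connected.pow_card_le_indepSum`). So
β is a simple root, with an explicit distance to every other root in the unit disc
(`Connected.pow_card_le_mul_norm_sub`). -/

namespace SimpleGraph

/-! ### Deletion recursion and domination of ratios. -/

section IndepSum

open Classical in
/-- The alternating independence sum `∑ (-z)^|s|` over the independent sets `s ⊆ A`. -/
noncomputable def indepSum {V : Type u} (G : SimpleGraph V) {R : Type*} [CommRing R]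
    (A : Finset V) (z : R) : R :=
  ∑ s ∈ A.powerset.filter fun s : Finset V => G.IsIndepSet (s : Set V), (-z) ^ s.card

open Classical in
theorem aeval_indepPoly {V : Type u} [Fintype V] (G : SimpleGraph V) {R : Type*} [CommRing R]
    (z : R) : aeval z G.indepPoly = G.indepSum Finset.univ z := by
  have hcard : ∀ k, G.numIndepSets k =
      ((Finset.univ.powerset.filter fun s : Finset V => G.IsIndepSet (s : Set V)).filter
        fun s => s.card = k).card := by
    intro k
    rw [numIndepSets, ← Set.ncard_coe_finset]
    congr 1
    ext s
    simp [isNIndepSet_iff]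
  rw [indepPoly, map_sum, indepSum,
    ← Finset.sum_fiberwise_of_maps_to (g := Finset.card)
      (t := Finset.range (Fintype.card V + 1))]
  · refine Finset.sum_congr rfl fun k _ => ?_
    rw [Finset.sum_congr rfl (g := fun _ => (-z) ^ k)]
    · rw [Finset.sum_const, ← hcard]
      simp [neg_pow z k]
      ring
    · intro s hs
      rw [(Finset.mem_filter.mp hs).2]
  · intro s _
    rw [Finset.mem_range]
    have := s.card_le_univ
    omega

variable {V : Type u} (G : SimpleGraph V)

@[simp]
theorem indepSum_empty {R : Type*} [CommRing R] (z : R) : G.indepSum ∅ z = 1 := by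
  simp [indepSum, Finset.filter_singleton]

@[simp]
theorem indepSum_zero_right {R : Type*} [CommRing R] (A : Finset V) :
    G.indepSum A (0 : R) = 1 := by
  classical
  rw [indepSum, Finset.sum_eq_single ∅]
  · simp
  · intro s _ hs
    simp [hs]
  · simp

theorem ofReal_indepSum (A : Finset V) (x : ℝ) :
    ((G.indepSum A x : ℝ) : ℂ) = G.indepSum A (x : ℂ) := by
  simp [indepSum]

theorem continuous_indepSum (A : Finset V) : Continuous fun x : ℝ => G.indepSum A x := by
  unfold indepSum
  fun_prop

theorem indepSum_pos_of_nonpos (A : Finset V) {x : ℝ} (hx : x ≤ 0) : 0 < G.indepSum A x := by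
  classical
  refine Finset.sum_pos' (fun s _ => pow_nonneg (by linarith) _) ⟨∅, ?_, by simp⟩
  simp

open Classical in
/-- The vertices of `A` outside the closed neighbourhood of `v`. -/
noncomputable def nonNbrs (A : Finset V) (v : V) : Finset V :=
  (A.erase v).filter fun u => ¬ G.Adj v u

open Classical in
theorem nonNbrs_subset_erase (A : Finset V) (v : V) : G.nonNbrs A v ⊆ A.erase v :=
  Finset.filter_subset _ _

open Classical in
theorem mem_nonNbrs {A : Finset V} {v u : V} :
    u ∈ G.nonNbrs A v ↔ (u ≠ v ∧ u ∈ A) ∧ ¬ G.Adj v u := by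
  simp [nonNbrs]

open Classical in
theorem indepSum_eq_erase {R : Type*} [CommRing R] {A : Finset V} {v : V} (hv : v ∈ A) (z : R) :
    G.indepSum A z = G.indepSum (A.erase v) z - z * G.indepSum (G.nonNbrs A v) z := by
  unfold indepSum
  rw [← Finset.sum_filter_add_sum_filter_not _ (fun s => v ∉ s), sub_eq_add_neg]
  congr 1
  · refine Finset.sum_congr ?_ fun _ _ => rfl
    ext s
    simp only [Finset.mem_filter, Finset.mem_powerset, Finset.subset_erase]
    tauto
  · rw [Finset.mul_sum, ← Finset.sum_neg_distrib]
    refine Finset.sum_nbij' (fun s => s.erase v) (fun s => insert v s) ?_ ?_ ?_ ?_ ?_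
    · intro s hs
      simp only [Finset.mem_filter, Finset.mem_powerset, not_not] at hs ⊢
      obtain ⟨⟨hsA, hs⟩, hvs⟩ := hs
      refine ⟨fun u hu => ?_, ?_⟩
      · rw [Finset.mem_erase] at hu
        exact (G.mem_nonNbrs).2 ⟨⟨hu.1, hsA hu.2⟩, hs hvs hu.2 hu.1.symm⟩
      · exact hs.mono (by simp)
    · intro s hs
      simp only [Finset.mem_filter, Finset.mem_powerset, not_not] at hs ⊢
      obtain ⟨hsA, hs⟩ := hs
      refine ⟨⟨?_, ?_⟩, by simp⟩
      · intro u hu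
        rcases Finset.mem_insert.1 hu with rfl | hu
        · exact hv
        · exact ((G.mem_nonNbrs).1 (hsA hu)).1.2
      · rw [Finset.coe_insert, isIndepSet_iff, Set.pairwise_insert]
        refine ⟨hs, fun u hu _ => ?_⟩
        have := ((G.mem_nonNbrs).1 (hsA hu)).2
        exact ⟨this, fun h => this h.symm⟩
    · intro s hs
      simp only [Finset.mem_filter, not_not] at hs
      exact Finset.insert_erase hs.2
    · intro s hs
      simp only [Finset.mem_filter, Finset.mem_powerset] at hs
      exact Finset.erase_insert fun h => ((G.mem_nonNbrs).1 (hs.1 h)).1.1 rfl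
    · intro s hs
      simp only [Finset.mem_filter, not_not] at hs
      rw [← Finset.card_erase_add_one hs.2, pow_succ]
      ring

-- One deleted vertex gives I(A - v)/I(A) = 1/(1 - z F), and |1 - zF| ≥ 1 - |zF| compares it with
-- its value at r. General B ⊆ A follows by multiplying such ratios. Subtracting 1 keeps the
-- nonnegative-coefficient pattern needed by the induction.
open Classical in
theorem indepSum_ratio_aux {z : ℂ} {r : ℝ} (hz : ‖z‖ ≤ r) (A : Finset V) :
    (∀ B ⊆ A, 0 < G.indepSum B r) →
    G.indepSum A z ≠ 0 ∧ ∀ B ⊆ A, ‖G.indepSum B z / G.indepSum A z - 1‖ ≤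
      G.indepSum B r / G.indepSum A r - 1 := by
  induction A using Finset.strongInduction with
  | H A ih =>
  intro hA
  have hr : 0 ≤ r := (norm_nonneg z).trans hz
  have key : ∀ v ∈ A, G.indepSum A z ≠ 0 ∧ G.indepSum (A.erase v) z ≠ 0 ∧
      ‖G.indepSum (A.erase v) z / G.indepSum A z - 1‖ ≤
        G.indepSum (A.erase v) r / G.indepSum A r - 1 ∧
      ∀ B ⊆ A.erase v, ‖G.indepSum B z / G.indepSum (A.erase v) z - 1‖ ≤
        G.indepSum B r / G.indepSum (A.erase v) r - 1 := by
    intro v hv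
    obtain ⟨h0, h1⟩ := ih _ (Finset.erase_ssubset hv)
      fun B hB => hA B (hB.trans (Finset.erase_subset _ _))
    have hF := h1 _ (G.nonNbrs_subset_erase A v)
    have e1 := G.indepSum_eq_erase hv z
    have e2 := G.indepSum_eq_erase hv r
    have p0 := hA A subset_rfl
    have p1 := hA _ (Finset.erase_subset v A)
    set a := G.indepSum A z
    set b := G.indepSum (A.erase v) z
    set c := G.indepSum (G.nonNbrs A v) z
    set a' := G.indepSum A r
    set b' := G.indepSum (A.erase v) r
    set c' := G.indepSum (G.nonNbrs A v) r
    have hF' : ‖c / b‖ ≤ c' / b' := by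
      have := norm_add_le (c / b - 1) 1
      simp only [sub_add_cancel, norm_one] at this
      linarith
    have e1' : a / b = 1 - z * (c / b) := by rw [e1]; field_simp
    have e2' : a' / b' = 1 - r * (c' / b') := by rw [e2]; field_simp
    have hzF : ‖z * (c / b)‖ ≤ r * (c' / b') := by
      rw [norm_mul]; gcongr
    have hge : a' / b' ≤ ‖a / b‖ := by
      have := norm_sub_norm_le (1 : ℂ) (z * (c / b))
      rw [norm_one] at this
      rw [e1', e2']
      linarith
    have hpos : 0 < a' / b' := div_pos p0 p1
    have ha : a ≠ 0 := by
      intro h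
      rw [h, zero_div, norm_zero] at hge
      linarith
    refine ⟨ha, h0, ?_, h1⟩
    have hQ : ‖b / a‖ ≤ b' / a' := by
      rw [← inv_div a b, ← inv_div a' b', norm_inv]
      exact inv_anti₀ hpos hge
    have d1 : b / a - 1 = z * (c / b) * (b / a) := by
      have : z * c = b - a := by rw [e1]; ring
      field_simp
      rw [this]
    have d2 : b' / a' - 1 = r * (c' / b') * (b' / a') := by
      have : r * c' = b' - a' := by rw [e2]; ring
      field_simp
      rw [this]
    rw [d1, d2, norm_mul]
    exact mul_le_mul hzF hQ (norm_nonneg _) ((norm_nonneg _).trans hzF)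
  rcases A.eq_empty_or_nonempty with rfl | ⟨w, hw⟩
  · refine ⟨by simp, fun B hB => ?_⟩
    rw [Finset.subset_empty.1 hB]
    simp
  · refine ⟨(key w hw).1, fun B hB => ?_⟩
    rcases hB.eq_or_ssubset with rfl | hB
    · rw [div_self (key w hw).1, div_self (hA B subset_rfl).ne']
      simp
    · obtain ⟨v, hv, hvB⟩ := Finset.exists_of_ssubset hB
      obtain ⟨k0, k1, k2, k3⟩ := key v hv
      have k4 := k3 B (Finset.subset_erase.2 ⟨hB.subset, hvB⟩)
      have p0 := hA A subset_rfl
      have p1 := hA _ (Finset.erase_subset v A)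
      set a := G.indepSum A z
      set b := G.indepSum (A.erase v) z
      set c := G.indepSum B z
      set a' := G.indepSum A r
      set b' := G.indepSum (A.erase v) r
      set c' := G.indepSum B r
      have d1 : c / a - 1 = (c / b - 1) * (b / a) + (b / a - 1) := by field_simp; ring
      have d2 : c' / a' - 1 = (c' / b' - 1) * (b' / a') + (b' / a' - 1) := by field_simp; ring
      have hQ : ‖b / a‖ ≤ b' / a' := by
        have := norm_add_le (b / a - 1) 1
        simp only [sub_add_cancel, norm_one] at this
        linarith
      rw [d1, d2]
      refine (norm_add_le _ _).trans (add_le_add ?_ k2)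
      rw [norm_mul]
      exact mul_le_mul k4 hQ (norm_nonneg _) ((norm_nonneg _).trans k4)

theorem indepSum_ne_zero {z : ℂ} {r : ℝ} (hz : ‖z‖ ≤ r) {A : Finset V}
    (hA : ∀ B ⊆ A, 0 < G.indepSum B r) : G.indepSum A z ≠ 0 :=
  (G.indepSum_ratio_aux hz A hA).1

theorem norm_indepSum_ratio_sub_one_le {z : ℂ} {r : ℝ} (hz : ‖z‖ ≤ r) {A B : Finset V}
    (hA : ∀ B ⊆ A, 0 < G.indepSum B r) (hB : B ⊆ A) :
    ‖G.indepSum B z / G.indepSum A z - 1‖ ≤ G.indepSum B r / G.indepSum A r - 1 :=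
  (G.indepSum_ratio_aux hz A hA).2 B hB

theorem norm_indepSum_ratio_le {z : ℂ} {r : ℝ} (hz : ‖z‖ ≤ r) {A B : Finset V}
    (hA : ∀ B ⊆ A, 0 < G.indepSum B r) (hB : B ⊆ A) :
    ‖G.indepSum B z / G.indepSum A z‖ ≤ G.indepSum B r / G.indepSum A r := by
  have h := G.norm_indepSum_ratio_sub_one_le hz hA hB
  have := norm_add_le (G.indepSum B z / G.indepSum A z - 1) 1
  simp only [sub_add_cancel, norm_one] at this
  linarith

theorem indepSum_ratio_mono {s r : ℝ} (hs : 0 ≤ s) (hsr : s ≤ r) {A B : Finset V}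
    (hA : ∀ B ⊆ A, 0 < G.indepSum B r) (hB : B ⊆ A) :
    G.indepSum B s / G.indepSum A s ≤ G.indepSum B r / G.indepSum A r := by
  have h := G.norm_indepSum_ratio_le (z := (s : ℂ))
    (by rwa [Complex.norm_real, Real.norm_of_nonneg hs]) hA hB
  rw [← ofReal_indepSum, ← ofReal_indepSum, ← Complex.ofReal_div, Complex.norm_real] at h
  exact (le_abs_self _).trans h

-- For a strict subset the ratio series has linear coefficient at least 1, so domination survives
-- the removal of 1 + z.
open Classical in
theorem norm_indepSum_ratio_sub_one_sub_le {z : ℂ} {r : ℝ} (hz : ‖z‖ ≤ r) {A B : Finset V}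
    (hA : ∀ B ⊆ A, 0 < G.indepSum B r) (hB : B ⊂ A) :
    ‖G.indepSum B z / G.indepSum A z - 1 - z‖ ≤ G.indepSum B r / G.indepSum A r - 1 - r := by
  obtain ⟨v, hv, hvB⟩ := Finset.exists_of_ssubset hB
  have hr : 0 ≤ r := (norm_nonneg z).trans hz
  have hE : ∀ B ⊆ A.erase v, 0 < G.indepSum B r :=
    fun B hB => hA B (hB.trans (Finset.erase_subset _ _))
  have ha := G.indepSum_ne_zero hz hA
  have hb := G.indepSum_ne_zero hz hE
  have k4 := G.norm_indepSum_ratio_sub_one_le hz hE (Finset.subset_erase.2 ⟨hB.subset, hvB⟩)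
  have k5 := G.norm_indepSum_ratio_sub_one_le hz hA
    ((G.nonNbrs_subset_erase A v).trans (Finset.erase_subset _ _))
  have hQ := G.norm_indepSum_ratio_le hz hA (Finset.erase_subset v A)
  have e1 := G.indepSum_eq_erase hv z
  have e2 := G.indepSum_eq_erase hv r
  have p0 := hA A subset_rfl
  have p1 := hA _ (Finset.erase_subset v A)
  set a := G.indepSum A z
  set b := G.indepSum (A.erase v) z
  set c := G.indepSum B z
  set d := G.indepSum (G.nonNbrs A v) z
  set a' := G.indepSum A r
  set b' := G.indepSum (A.erase v) r
  set c' := G.indepSum B r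
  set d' := G.indepSum (G.nonNbrs A v) r
  have d1 : c / a - 1 - z = (c / b - 1) * (b / a) + z * (d / a - 1) := by
    have : z * (d / a - 1) = (b - a) / a - z := by
      have : b - a = z * d := by rw [e1]; ring
      rw [this]; ring
    rw [this]
    field_simp
    ring
  have d2 : c' / a' - 1 - r = (c' / b' - 1) * (b' / a') + r * (d' / a' - 1) := by
    have : r * (d' / a' - 1) = (b' - a') / a' - r := by
      have : b' - a' = r * d' := by rw [e2]; ring
      rw [this]; ring
    rw [this]
    field_simp
    ring
  rw [d1, d2]
  refine (norm_add_le _ _).trans (add_le_add ?_ ?_)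
  · rw [norm_mul]
    exact mul_le_mul k4 hQ (norm_nonneg _) ((norm_nonneg _).trans k4)
  · rw [norm_mul]
    exact mul_le_mul hz k5 (norm_nonneg _) hr

end IndepSum

end SimpleGraph

/-! ### First roots, monotonicity in the vertex set, and Lipschitz bounds. -/

namespace SimpleGraph

section IndepSum

variable {V : Type u} (G : SimpleGraph V)

theorem exists_first_root_indepSum {A : Finset V} {t : ℝ} (ht : G.indepSum A t ≤ 0) :
    ∃ m, 0 < m ∧ m ≤ t ∧ G.indepSum A m = 0 ∧ ∀ s < m, 0 < G.indepSum A s := by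
  have hc := G.continuous_indepSum A
  have ivt : ∀ u : ℝ, G.indepSum A u ≤ 0 → ∃ m ∈ Set.Icc 0 u, G.indepSum A m = 0 := by
    intro u hu
    have h0 : 0 ≤ u := by
      by_contra! h
      exact hu.not_gt (G.indepSum_pos_of_nonpos A h.le)
    exact intermediate_value_Icc' h0 hc.continuousOn ⟨hu, by simp⟩
  have hK : IsCompact (Set.Icc 0 t ∩ {s : ℝ | G.indepSum A s = 0}) :=
    isCompact_Icc.inter_right (isClosed_eq hc continuous_const)
  obtain ⟨m, ⟨hm, hm0⟩, hmin⟩ := hK.exists_isLeast (ivt t ht)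
  refine ⟨m, ?_, hm.2, hm0, fun s hs => ?_⟩
  · by_contra! h
    exact (G.indepSum_pos_of_nonpos A h).ne' hm0
  · by_contra! h
    obtain ⟨u, hu, hu0⟩ := ivt s h
    exact (hmin ⟨⟨hu.1, hu.2.trans (hs.le.trans hm.2)⟩, hu0⟩).not_gt (hu.2.trans_lt hs)

open Classical in
theorem indepSum_pos_of_subset (A : Finset V) :
    ∀ {x : ℝ}, (∀ s < x, 0 < G.indepSum A s) → ∀ B ⊆ A, ∀ s < x, 0 < G.indepSum B s := by
  induction A using Finset.strongInduction with
  | H A ih =>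
  intro x hA B hB
  rcases hB.eq_or_ssubset with rfl | hB
  · exact hA
  obtain ⟨v, hv, hvB⟩ := Finset.exists_of_ssubset hB
  refine ih _ (Finset.erase_ssubset hv) (fun s hs => ?_) B
    (Finset.subset_erase.2 ⟨hB.subset, hvB⟩)
  -- At the first root m of A - v the recursion leaves I(A, m) = -m I(A - N[v], m) ≤ 0,
  -- contradicting positivity for A.
  by_contra! hneg
  obtain ⟨m, hm, hms, hm0, hmp⟩ := G.exists_first_root_indepSum hneg
  have h1 : 0 ≤ G.indepSum (G.nonNbrs A v) m := by
    refine ge_of_tendsto (((G.continuous_indepSum (G.nonNbrs A v)).tendsto m).mono_left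
      (nhdsWithin_le_nhds (s := Set.Iio m))) ?_
    filter_upwards [self_mem_nhdsWithin] with s hs
    exact (ih _ (Finset.erase_ssubset hv) hmp _ (G.nonNbrs_subset_erase A v) s hs).le
  have h2 := hA m (hms.trans_lt hs)
  rw [G.indepSum_eq_erase hv, hm0] at h2
  nlinarith

theorem indepSum_nonneg_of_subset {A : Finset V} {x : ℝ} (hA : ∀ s < x, 0 < G.indepSum A s)
    {B : Finset V} (hB : B ⊆ A) : 0 ≤ G.indepSum B x := by
  refine ge_of_tendsto (((G.continuous_indepSum B).tendsto x).mono_left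
    (nhdsWithin_le_nhds (s := Set.Iio x))) ?_
  filter_upwards [self_mem_nhdsWithin] with s hs
  exact (G.indepSum_pos_of_subset A hA B hB s hs).le

theorem indepSum_le_of_subset {A : Finset V} {x : ℝ} (hx : 0 ≤ x)
    (hA : ∀ B ⊆ A, 0 ≤ G.indepSum B x) {B : Finset V} (hB : B ⊆ A) :
    G.indepSum A x ≤ G.indepSum B x := by
  classical
  induction A using Finset.strongInduction with
  | H A ih =>
  rcases hB.eq_or_ssubset with rfl | hB
  · exact le_rfl
  obtain ⟨v, hv, hvB⟩ := Finset.exists_of_ssubset hB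
  refine le_trans ?_ (ih _ (Finset.erase_ssubset hv)
    (fun C hC => hA C (hC.trans (Finset.erase_subset _ _)))
    (Finset.subset_erase.2 ⟨hB.subset, hvB⟩))
  rw [G.indepSum_eq_erase hv]
  have := hA _ ((G.nonNbrs_subset_erase A v).trans (Finset.erase_subset _ _))
  nlinarith

theorem Connected.exists_adj_boundary {G : SimpleGraph V} (hG : G.Connected) {A : Finset V}
    (hA : A.Nonempty) {w : V} (hw : w ∉ A) : ∃ u ∈ A, ∃ p ∉ A, G.Adj p u := by
  obtain ⟨a, ha⟩ := hA
  obtain ⟨p⟩ := hG.preconnected a w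
  obtain ⟨d, -, h1, h2⟩ := p.exists_boundary_dart (A : Set V) ha hw
  exact ⟨_, h1, _, h2, d.adj.symm⟩

/-- Take an edge from p outside A to u in A. Nonnegativity for A + p gives I(A) ≥ x I(A - N(p)) ≥ x
I(A - u), so each vertex of A costs one factor x. -/
theorem Connected.pow_card_le_indepSum {G : SimpleGraph V} (hG : G.Connected) {x : ℝ}
    (hx : 0 ≤ x) (hpos : ∀ B : Finset V, 0 ≤ G.indepSum B x) {w : V} (A : Finset V) (hw : w ∉ A) :
    x ^ A.card ≤ G.indepSum A x := by
  classical
  induction A using Finset.strongInduction with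
  | H A ih =>
  rcases A.eq_empty_or_nonempty with rfl | hne
  · simp
  obtain ⟨u, hu, p, hp, hadj⟩ := hG.exists_adj_boundary hne hw
  have h1 := hpos (insert p A)
  rw [G.indepSum_eq_erase (Finset.mem_insert_self p A), Finset.erase_insert hp] at h1
  have hsub : G.nonNbrs (insert p A) p ⊆ A.erase u := by
    intro y hy
    rw [mem_nonNbrs] at hy
    obtain ⟨⟨h2, h3⟩, h4⟩ := hy
    rw [Finset.mem_erase]
    refine ⟨fun h => h4 (h ▸ hadj), (Finset.mem_insert.1 h3).resolve_left h2⟩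
  have h2 := G.indepSum_le_of_subset hx (fun B _ => hpos B) hsub
  have h3 := ih _ (Finset.erase_ssubset hu) (fun h => hw (Finset.mem_of_mem_erase h))
  rw [← Finset.card_erase_add_one hu, pow_succ]
  nlinarith [mul_le_mul_of_nonneg_left (h3.trans h2) hx]

open Classical in
/-- The divided difference of `indepSum` between `z` and `w`. -/
noncomputable def indepSumDiv (A : Finset V) (z w : ℂ) : ℂ :=
  -∑ s ∈ A.powerset.filter fun s : Finset V => G.IsIndepSet (s : Set V),
    ∑ i ∈ Finset.range s.card, (-z) ^ i * (-w) ^ (s.card - 1 - i)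

theorem indepSum_sub_indepSum (A : Finset V) (z w : ℂ) :
    G.indepSum A z - G.indepSum A w = G.indepSumDiv A z w * (z - w) := by
  classical
  rw [indepSum, indepSum, ← Finset.sum_sub_distrib, indepSumDiv, neg_mul, Finset.sum_mul,
    ← Finset.sum_neg_distrib]
  refine Finset.sum_congr rfl fun s _ => ?_
  rw [← (Commute.all (-z) (-w)).geom_sum₂_mul]
  ring

theorem norm_neg_pow_sub_pow_le {z w : ℂ} (hz : ‖z‖ ≤ 1) (hw : ‖w‖ ≤ 1) (k : ℕ) :
    ‖(-z) ^ k - (-w) ^ k‖ ≤ k * ‖z - w‖ := by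
  rw [← (Commute.all (-z) (-w)).geom_sum₂_mul, norm_mul, ← norm_neg (z - w)]
  have : -z - -w = -(z - w) := by ring
  rw [this]
  gcongr
  refine (norm_sum_le_of_le _ (f := fun i => (-z) ^ i * (-w) ^ (k - 1 - i)) (n := fun _ => 1)
    fun i _ => ?_).trans (by simp)
  rw [norm_mul, norm_pow, norm_pow, norm_neg, norm_neg]
  exact mul_le_one₀ (pow_le_one₀ (norm_nonneg _) hz) (by positivity)
    (pow_le_one₀ (norm_nonneg _) hw)

open Classical in
theorem card_indepSets_le (A : Finset V) :
    (((A.powerset.filter fun s : Finset V => G.IsIndepSet (s : Set V)).card : ℕ) : ℝ) ≤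
      2 ^ A.card := by
  have := Finset.card_filter_le A.powerset fun s : Finset V => G.IsIndepSet (s : Set V)
  rw [Finset.card_powerset] at this
  exact_mod_cast this

theorem norm_indepSum_sub_le {z w : ℂ} (hz : ‖z‖ ≤ 1) (hw : ‖w‖ ≤ 1) {A : Finset V} {n : ℕ}
    (hA : A.card ≤ n) :
    ‖G.indepSum A z - G.indepSum A w‖ ≤ n * 2 ^ n * ‖z - w‖ := by
  classical
  rw [indepSum, indepSum, ← Finset.sum_sub_distrib]
  refine (norm_sum_le_of_le _ (n := fun _ => n * ‖z - w‖) fun s hs => ?_).trans ?_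
  · refine (norm_neg_pow_sub_pow_le hz hw _).trans ?_
    have := Finset.card_le_card (Finset.mem_powerset.1 (Finset.mem_filter.1 hs).1)
    gcongr
    exact this.trans hA
  · rw [Finset.sum_const, nsmul_eq_mul]
    have h : (2 : ℝ) ^ A.card ≤ 2 ^ n := pow_le_pow_right₀ one_le_two hA
    have := mul_le_mul_of_nonneg_right ((G.card_indepSets_le A).trans h)
      (by positivity : 0 ≤ n * ‖z - w‖)
    linarith

theorem abs_indepSum_sub_le {x y : ℝ} (hx : |x| ≤ 1) (hy : |y| ≤ 1) {A : Finset V} {n : ℕ}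
    (hA : A.card ≤ n) :
    |G.indepSum A x - G.indepSum A y| ≤ n * 2 ^ n * |x - y| := by
  have := G.norm_indepSum_sub_le (z := (x : ℂ)) (w := (y : ℂ)) (by simpa using hx)
    (by simpa using hy) hA
  simpa only [← ofReal_indepSum, ← Complex.ofReal_sub, Complex.norm_real, Real.norm_eq_abs]
    using this

theorem norm_indepSumDiv_sub_le {z y w : ℂ} (hz : ‖z‖ ≤ 1) (hy : ‖y‖ ≤ 1) (hw : ‖w‖ ≤ 1)
    {A : Finset V} {n : ℕ} (hA : A.card ≤ n) :
    ‖G.indepSumDiv A z w - G.indepSumDiv A y w‖ ≤ n ^ 2 * 2 ^ n * ‖z - y‖ := by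
  classical
  rw [indepSumDiv, indepSumDiv, neg_sub_neg, ← Finset.sum_sub_distrib]
  refine (norm_sum_le_of_le _ (n := fun _ => n ^ 2 * ‖z - y‖) fun s hs => ?_).trans ?_
  · have hs : s.card ≤ n :=
      (Finset.card_le_card (Finset.mem_powerset.1 (Finset.mem_filter.1 hs).1)).trans hA
    have hs' : (s.card : ℝ) ≤ n := by exact_mod_cast hs
    rw [← Finset.sum_sub_distrib]
    refine (norm_sum_le_of_le _ (n := fun _ => n * ‖z - y‖) fun i hi => ?_).trans ?_
    · rw [← sub_mul, norm_mul, norm_pow, norm_neg]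
      have hi : (i : ℝ) ≤ n := by
        have := Finset.mem_range.1 hi
        exact_mod_cast (this.le.trans hs)
      have h1 := norm_neg_pow_sub_pow_le hy hz i
      rw [norm_sub_rev y z] at h1
      have h2 : ‖w‖ ^ (s.card - 1 - i) ≤ 1 := pow_le_one₀ (norm_nonneg _) hw
      calc _ ≤ (i * ‖z - y‖) * 1 := by gcongr
        _ ≤ _ := by rw [mul_one]; gcongr
    · rw [Finset.sum_const, nsmul_eq_mul, Finset.card_range]
      have := mul_le_mul_of_nonneg_right hs' (by positivity : 0 ≤ n * ‖z - y‖)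
      linarith
  · rw [Finset.sum_const, nsmul_eq_mul]
    have h : (2 : ℝ) ^ A.card ≤ 2 ^ n := pow_le_pow_right₀ one_le_two hA
    have := mul_le_mul_of_nonneg_right ((G.card_indepSets_le A).trans h)
      (by positivity : 0 ≤ n ^ 2 * ‖z - y‖)
    linarith

end IndepSum

end SimpleGraph

/-! ### Quantitative separation of β from the other roots. -/

namespace SimpleGraph

section IndepSum

variable {V : Type u} [Fintype V] {G : SimpleGraph V}

theorem Connected.exists_smallest_root (hG : G.Connected) (hn : 2 ≤ Fintype.card V) :
    ∃ β : ℝ, 0 < β ∧ β ≤ 1 / 2 ∧ G.indepSum Finset.univ β = 0 ∧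
      ∀ s < β, 0 < G.indepSum Finset.univ s := by
  classical
  have : Nontrivial V := Fintype.one_lt_card_iff_nontrivial.1 hn
  obtain ⟨v⟩ := hG.nonempty
  obtain ⟨u, hu⟩ := hG.preconnected.exists_adj_of_nontrivial v
  -- An edge has sum 1 - 2z, and enlarging the vertex set only decreases the sum while all sums are
  -- nonnegative, hence β ≤ 1/2.
  have hedge : G.indepSum {v, u} (1 / 2 : ℝ) = 0 := by
    rw [G.indepSum_eq_erase (v := v) (by simp)]
    have e1 : ({v, u} : Finset V).erase v = {u} := by
      rw [Finset.erase_insert (by simpa using hu.ne)]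
    have e2 : G.nonNbrs {v, u} v = ∅ := by
      ext x
      simp only [mem_nonNbrs, Finset.mem_insert, Finset.mem_singleton, Finset.notMem_empty,
        iff_false]
      rintro ⟨⟨h1, h2⟩, h3⟩
      exact h3 (h2.resolve_left h1 ▸ hu)
    have e3 : G.nonNbrs {u} u = ∅ := by
      ext x
      simp only [mem_nonNbrs, Finset.mem_singleton, Finset.notMem_empty, iff_false]
      tauto
    rw [e1, e2, G.indepSum_eq_erase (Finset.mem_singleton_self u), e3]
    simp
    norm_num
  by_cases h : ∃ s : ℝ, s ≤ 1 / 2 ∧ G.indepSum Finset.univ s ≤ 0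
  · obtain ⟨s, hs, hs0⟩ := h
    obtain ⟨m, h1, h2, h3⟩ := G.exists_first_root_indepSum hs0
    exact ⟨m, h1, h2.trans hs, h3⟩
  · push Not at h
    have := G.indepSum_le_of_subset (x := 1 / 2) (by norm_num)
      (fun B hB => G.indepSum_nonneg_of_subset (fun s hs => h s hs.le) hB)
      (Finset.subset_univ {v, u})
    exact absurd (h _ le_rfl) (by linarith)

open Classical in
theorem Connected.pow_card_le_indepSum_erase (hG : G.Connected) {β : ℝ} (hβ : 0 < β)
    (hβ1 : β ≤ 1) (hpos : ∀ s < β, 0 < G.indepSum Finset.univ s) {v : V} {B : Finset V}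
    (hB : B ⊆ Finset.univ.erase v) : β ^ Fintype.card V ≤ G.indepSum B β :=
  (pow_le_pow_of_le_one hβ.le hβ1 B.card_le_univ).trans
    (hG.pow_card_le_indepSum hβ.le
      (fun _ => G.indepSum_nonneg_of_subset hpos (Finset.subset_univ _)) B
      fun h => (Finset.mem_erase.1 (hB h)).1 rfl)

/-- Quantitative simplicity of β: F is increasing with F(β) = 1/β, so I(V, r) = I(V - v, r)(1 - r
F(r)) ≥ I(V - v, β)(1 - r/β). -/
theorem Connected.pow_card_mul_le_indepSum (hG : G.Connected) {β : ℝ} (hβ : 0 < β)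
    (hβ1 : β ≤ 1) (h0 : G.indepSum Finset.univ β = 0)
    (hpos : ∀ s < β, 0 < G.indepSum Finset.univ s) {r : ℝ} (hr : 0 < r) (hrβ : r < β) :
    β ^ Fintype.card V * (β - r) ≤ G.indepSum Finset.univ r := by
  classical
  obtain ⟨v⟩ := hG.nonempty
  have hP : ∀ B ⊆ Finset.univ.erase v, 0 < G.indepSum B β := fun B hB =>
    (pow_pos hβ _).trans_le (hG.pow_card_le_indepSum_erase hβ hβ1 hpos hB)
  have hb := hG.pow_card_le_indepSum_erase hβ hβ1 hpos (subset_refl (Finset.univ.erase v))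
  have hF := G.indepSum_ratio_mono hr.le hrβ.le hP (G.nonNbrs_subset_erase Finset.univ v)
  have hE := G.indepSum_ratio_mono hr.le hrβ.le hP (Finset.empty_subset _)
  have hbr := G.indepSum_pos_of_subset Finset.univ hpos _ (Finset.erase_subset v _) r hrβ
  have hbp := hP _ subset_rfl
  rw [G.indepSum_eq_erase (Finset.mem_univ v)] at h0 ⊢
  rw [indepSum_empty, indepSum_empty, div_le_div_iff_of_pos_left one_pos hbr hbp] at hE
  set b := G.indepSum (Finset.univ.erase v) β
  set c := G.indepSum (G.nonNbrs Finset.univ v) β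
  set b' := G.indepSum (Finset.univ.erase v) r
  set c' := G.indepSum (G.nonNbrs Finset.univ v) r
  have h1 : c / b = 1 / β := by
    rw [div_eq_div_iff hbp.ne' hβ.ne']
    linarith
  rw [h1, div_le_div_iff₀ hbr hβ, one_mul] at hF
  calc β ^ Fintype.card V * (β - r) ≤ b' * (β - r) :=
        mul_le_mul_of_nonneg_right (hb.trans hE) (by linarith)
    _ ≤ b' * (1 - r / β) := by
        refine mul_le_mul_of_nonneg_left ?_ hbr.le
        rw [one_sub_div hβ.ne', le_div_iff₀ hβ]
        nlinarith
    _ ≤ b' - r * c' := by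
        have : c' ≤ b' / β := by rwa [le_div_iff₀ hβ]
        have := mul_le_mul_of_nonneg_left this hr.le
        have e : b' * (1 - r / β) = b' - r * (b' / β) := by ring
        linarith

/-- The divided difference against β vanishes at z but has modulus at least β^n at every r in (0,
β). Its Lipschitz bound keeps z away from r; then r tends to β. -/
theorem Connected.pow_card_le_mul_norm_sub (hG : G.Connected) {β : ℝ} (hβ : 0 < β)
    (hβ1 : β ≤ 1) (h0 : G.indepSum Finset.univ β = 0)
    (hpos : ∀ s < β, 0 < G.indepSum Finset.univ s) {z : ℂ} (hz : ‖z‖ ≤ 1)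
    (hz0 : G.indepSum Finset.univ z = 0) (hne : z ≠ β) :
    β ^ Fintype.card V ≤ (Fintype.card V) ^ 2 * 2 ^ (Fintype.card V) * ‖z - β‖ := by
  have h0' : G.indepSum Finset.univ (β : ℂ) = 0 := by rw [← ofReal_indepSum, h0]; rfl
  have hD : G.indepSumDiv Finset.univ z β = 0 := by
    have := G.indepSum_sub_indepSum Finset.univ z β
    rw [hz0, h0', sub_zero, eq_comm, mul_eq_zero] at this
    exact this.resolve_right (sub_ne_zero.2 hne)
  have hlim : Filter.Tendsto (fun r : ℝ => ((Fintype.card V : ℝ)) ^ 2 * 2 ^ (Fintype.card V) *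
      ‖z - r‖) (nhdsWithin β (Set.Iio β))
      (nhds ((Fintype.card V) ^ 2 * 2 ^ (Fintype.card V) * ‖z - β‖)) :=
    (Continuous.tendsto (by fun_prop) β).mono_left nhdsWithin_le_nhds
  refine ge_of_tendsto hlim ?_
  filter_upwards [Ioo_mem_nhdsLT hβ] with r hr
  have hr' := sub_pos.2 hr.2
  have h1 := hG.pow_card_mul_le_indepSum hβ hβ1 h0 hpos hr.1 hr.2
  have h2 := G.norm_indepSumDiv_sub_le (z := z) (y := (r : ℂ)) (w := (β : ℂ)) (A := Finset.univ)
    hz (by rw [Complex.norm_real, Real.norm_of_nonneg hr.1.le]; linarith [hr.2])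
    (by rwa [Complex.norm_real, Real.norm_of_nonneg hβ.le]) le_rfl
  rw [hD, zero_sub, norm_neg] at h2
  refine le_trans ?_ h2
  have h3 := congrArg norm (G.indepSum_sub_indepSum Finset.univ (r : ℂ) β)
  rw [h0', sub_zero, ← ofReal_indepSum, norm_mul, ← Complex.ofReal_sub, Complex.norm_real,
    Complex.norm_real, Real.norm_of_nonneg (hpos r hr.2).le, norm_sub_rev,
    Real.norm_of_nonneg hr'.le] at h3
  rw [h3] at h1
  exact le_of_mul_le_mul_right h1 hr'

open Classical in
theorem indepSum_add_le_zero_of_root {v u : V} (huv : G.Adj v u) {z : ℂ}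
    (hP : ∀ B ⊆ Finset.univ.erase v, 0 < G.indepSum B ‖z‖)
    (hz0 : G.indepSum Finset.univ z = 0) :
    G.indepSum Finset.univ ‖z‖ + G.indepSum (Finset.univ.erase v) ‖z‖ *
      (‖z - ‖z‖‖ ^ 2 / (2 * (1 + ‖z‖))) ≤ 0 := by
  have hss : G.nonNbrs Finset.univ v ⊂ Finset.univ.erase v := by
    refine Finset.ssubset_iff_subset_ne.2 ⟨G.nonNbrs_subset_erase _ _, fun h => ?_⟩
    have : u ∈ G.nonNbrs Finset.univ v := by rw [h]; simpa using huv.ne'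
    exact ((G.mem_nonNbrs).1 this).2 huv
  have hF := G.norm_indepSum_ratio_sub_one_sub_le le_rfl hP hss
  have hb := G.indepSum_ne_zero le_rfl hP
  have hb' := hP _ subset_rfl
  rw [G.indepSum_eq_erase (Finset.mem_univ v)] at hz0 ⊢
  set r := ‖z‖ with hr
  have hr0 : 0 ≤ r := norm_nonneg z
  set b := G.indepSum (Finset.univ.erase v) z
  set c := G.indepSum (G.nonNbrs Finset.univ v) z
  set b' := G.indepSum (Finset.univ.erase v) r
  set c' := G.indepSum (G.nonNbrs Finset.univ v) r
  have hone : z * (c / b) = 1 := by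
    rw [← mul_div_assoc, div_eq_one_iff_eq hb]
    linear_combination -hz0
  have h1 : ‖1 - z * (1 + z)‖ ≤ r * (c' / b' - 1 - r) := by
    have : 1 - z * (1 + z) = z * (c / b - 1 - z) := by linear_combination -hone
    rw [this, norm_mul]
    exact mul_le_mul_of_nonneg_left hF hr0
  have h2 : 1 ≤ r * (c' / b' - 1 - r) + r * ‖1 + z‖ := by
    have := norm_add_le (1 - z * (1 + z)) (z * (1 + z))
    rw [sub_add_cancel, norm_one, norm_mul] at this
    linarith
  have hN : ‖1 + z‖ ≤ 1 + r := by simpa using norm_add_le 1 z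
  -- Both sides equal 2r(r - Re z), since r = |z|.
  have h3 : r * (1 + r - ‖1 + z‖) * (1 + r + ‖1 + z‖) = ‖z - r‖ ^ 2 := by
    have e0 : r ^ 2 = z.re ^ 2 + z.im ^ 2 := by
      rw [hr, Complex.sq_norm, Complex.normSq_apply]; ring
    have e1 : ‖1 + z‖ ^ 2 = (1 + z.re) ^ 2 + z.im ^ 2 := by
      rw [Complex.sq_norm, Complex.normSq_apply]; simp; ring
    have e2 : ‖z - r‖ ^ 2 = (z.re - r) ^ 2 + z.im ^ 2 := by
      rw [Complex.sq_norm, Complex.normSq_apply]; simp; ring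
    rw [e2]
    linear_combination (-r) * e1 + (r + 1) * e0
  have h4 : ‖z - r‖ ^ 2 / (2 * (1 + r)) ≤ r * (1 + r - ‖1 + z‖) := by
    rw [div_le_iff₀ (by linarith), ← h3]
    refine mul_le_mul_of_nonneg_left (by linarith) (mul_nonneg hr0 (by linarith))
  have h5 : 1 + ‖z - r‖ ^ 2 / (2 * (1 + r)) ≤ r * (c' / b') := by nlinarith
  have h6 := mul_le_mul_of_nonneg_left h5 hb'.le
  have h7 : b' * (r * (c' / b')) = r * c' := by field_simp
  linarith

/-- With t = (β/n)^n, the factors n and 2^n are absorbed by powers of t. A root with |z| < β + t^11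
would have |z - β| ≥ t^3, so -I(V, |z|) ≥ t^7/32, while the Lipschitz bound gives less than t^9. -/
theorem Connected.le_norm_of_root (hG : G.Connected) (hn : 2 ≤ Fintype.card V) {β : ℝ}
    (hβ : 0 < β) (hβ1 : β ≤ 1 / 2) (h0 : G.indepSum Finset.univ β = 0)
    (hpos : ∀ s < β, 0 < G.indepSum Finset.univ s) {z : ℂ}
    (hz0 : G.indepSum Finset.univ z = 0) (hne : z ≠ β) :
    β + ((β / Fintype.card V) ^ Fintype.card V) ^ 11 ≤ ‖z‖ := by
  classical
  have : Nontrivial V := Fintype.one_lt_card_iff_nontrivial.1 hn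
  obtain ⟨v⟩ := hG.nonempty
  obtain ⟨u, hu⟩ := hG.preconnected.exists_adj_of_nontrivial v
  by_contra! hlt
  set n := Fintype.card V with hndef
  have hn' : (2 : ℝ) ≤ n := by exact_mod_cast hn
  set e := β / n with he
  have he0 : 0 < e := by positivity
  have hen : e * n = β := by rw [he]; field_simp
  have he1 : e ≤ 1 / 4 := by
    rw [he, div_le_iff₀ (by linarith)]
    linarith
  set t := e ^ n with ht
  have ht0 : 0 < t := by positivity
  have hte : t ≤ e ^ 2 := pow_le_pow_of_le_one he0.le (by linarith) hn
  have ht1 : t ≤ 1 / 16 := hte.trans (by nlinarith)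
  have htβ : t ≤ β ^ n := by
    refine pow_le_pow_left₀ he0.le ?_ n
    nlinarith
  have h2t : 2 ^ n * t ≤ 1 := by
    rw [ht, ← mul_pow]
    exact pow_le_one₀ (by positivity) (by linarith)
  have hnt : (n : ℝ) ^ 2 * t ≤ 1 := by
    calc (n : ℝ) ^ 2 * t ≤ n ^ 2 * e ^ 2 := by gcongr
      _ = β ^ 2 := by rw [← hen]; ring
      _ ≤ 1 := pow_le_one₀ hβ.le (by linarith)
  have hM2 : (n : ℝ) ^ 2 * 2 ^ n * t ^ 2 ≤ 1 := by
    calc (n : ℝ) ^ 2 * 2 ^ n * t ^ 2 = (n ^ 2 * t) * (2 ^ n * t) := by ring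
      _ ≤ 1 := mul_le_one₀ hnt (by positivity) h2t
  have hM1 : (n : ℝ) * 2 ^ n * t ^ 2 ≤ 1 := by
    refine le_trans ?_ hM2
    gcongr
    nlinarith
  set M : ℝ := n * 2 ^ n with hM
  have hM0 : 0 < M := by positivity
  have ht11 : t ^ 11 ≤ t ^ 3 / 16 := by
    calc t ^ 11 = t ^ 3 * t * t ^ 7 := by ring
      _ ≤ t ^ 3 * (1 / 16) * 1 := by
        gcongr
        exact pow_le_one₀ ht0.le (by linarith)
      _ = _ := by ring
  have ht3 : t ^ 3 ≤ 1 := pow_le_one₀ ht0.le (by linarith)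
  have hMt : M * t ^ 11 ≤ t ^ 9 := by
    calc M * t ^ 11 = M * t ^ 2 * t ^ 9 := by ring
      _ ≤ 1 * t ^ 9 := by gcongr
      _ = t ^ 9 := one_mul _
  have ht9 : t ^ 9 ≤ t / 16 := by
    calc t ^ 9 = t * t * t ^ 7 := by ring
      _ ≤ t * (1 / 16) * 1 := by
        gcongr
        exact pow_le_one₀ ht0.le (by linarith)
      _ = _ := by ring
  have hzero : 0 < t ^ 11 := by positivity
  have hr1 : ‖z‖ ≤ 1 := by linarith
  have hval : ∀ s, β ≤ s → s < β + t ^ 11 →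
      t / 2 ≤ G.indepSum (Finset.univ.erase v) s := by
    intro s hs hs'
    have h1 := htβ.trans
      (hG.pow_card_le_indepSum_erase hβ (by linarith) hpos (subset_refl (Finset.univ.erase v)))
    have h2 := G.abs_indepSum_sub_le (x := s) (y := β) (A := Finset.univ.erase v) (n := n)
      (abs_le.2 ⟨by linarith, by linarith⟩) (abs_le.2 ⟨by linarith, by linarith⟩)
      (Finset.card_le_univ _)
    rw [abs_of_nonneg (by linarith : 0 ≤ s - β)] at h2
    have h3 : M * (s - β) ≤ M * t ^ 11 := mul_le_mul_of_nonneg_left (by linarith) hM0.le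
    have h4 := (abs_le.1 h2).1
    linarith
  -- Domination is needed slightly beyond β: the sum over V - v is at least t at β and cannot drop
  -- below t/2 within t^11.
  have hP : ∀ B ⊆ Finset.univ.erase v, 0 < G.indepSum B ‖z‖ := by
    intro B hB
    refine G.indepSum_pos_of_subset (Finset.univ.erase v) (x := β + t ^ 11) (fun s hs => ?_)
      B hB _ hlt
    rcases lt_or_ge s β with h | h
    · exact G.indepSum_pos_of_subset Finset.univ hpos _ (Finset.erase_subset v _) s h
    · exact (half_pos ht0).trans_le (hval s h hs)
  have hE := indepSum_add_le_zero_of_root hu hP hz0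
  have hb := hP _ subset_rfl
  have hr0 : 0 ≤ ‖z‖ := norm_nonneg z
  have hrβ : β ≤ ‖z‖ := by
    by_contra! h
    have h1 := hpos _ h
    have h2 : 0 ≤ ‖z - ‖z‖‖ ^ 2 / (2 * (1 + ‖z‖)) := by positivity
    nlinarith [mul_nonneg hb.le h2]
  have hsep : t ^ 3 ≤ ‖z - β‖ := by
    have h1 := hG.pow_card_le_mul_norm_sub hβ (by linarith) h0 hpos hr1 hz0 hne
    rw [← hndef] at h1
    calc t ^ 3 = t * t ^ 2 := by ring
      _ ≤ (n ^ 2 * 2 ^ n * ‖z - β‖) * t ^ 2 := by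
        gcongr
        exact htβ.trans h1
      _ = (n ^ 2 * 2 ^ n * t ^ 2) * ‖z - β‖ := by ring
      _ ≤ 1 * ‖z - β‖ := by gcongr
      _ = _ := one_mul _
  have hsep' : t ^ 3 / 2 ≤ ‖z - ‖z‖‖ := by
    have h1 := norm_sub_le_norm_sub_add_norm_sub z (‖z‖ : ℂ) (β : ℂ)
    rw [← Complex.ofReal_sub, Complex.norm_real, Real.norm_of_nonneg (by linarith)] at h1
    linarith
  have hquad : t ^ 6 / 16 ≤ ‖z - ‖z‖‖ ^ 2 / (2 * (1 + ‖z‖)) := by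
    rw [le_div_iff₀ (by linarith)]
    have h1 : (t ^ 3 / 2) ^ 2 ≤ ‖z - ‖z‖‖ ^ 2 := by gcongr
    have h2 : t ^ 6 / 16 * (2 * (1 + ‖z‖)) ≤ t ^ 6 / 16 * 4 := by
      gcongr
      linarith
    calc _ ≤ t ^ 6 / 16 * 4 := h2
      _ = (t ^ 3 / 2) ^ 2 := by ring
      _ ≤ _ := h1
  have hlow : t / 2 * (t ^ 6 / 16) ≤ -G.indepSum Finset.univ ‖z‖ := by
    have h1 := mul_le_mul (hval _ hrβ hlt) hquad (by positivity) hb.le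
    linarith
  have hup : -G.indepSum Finset.univ ‖z‖ < t ^ 9 := by
    have h2 := G.abs_indepSum_sub_le (x := ‖z‖) (y := β) (A := Finset.univ) (n := n)
      (abs_le.2 ⟨by linarith, by linarith⟩) (abs_le.2 ⟨by linarith, by linarith⟩)
      (Finset.card_le_univ _)
    rw [h0, sub_zero, abs_of_nonneg (by linarith : 0 ≤ ‖z‖ - β)] at h2
    have h3 : M * (‖z‖ - β) < M * t ^ 11 := mul_lt_mul_of_pos_left (by linarith) hM0
    have h4 := (abs_le.1 h2).1
    linarith
  have hcmp : t ^ 9 ≤ t / 2 * (t ^ 6 / 16) := by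
    calc t ^ 9 = t ^ 7 * (t * t) := by ring
      _ ≤ t ^ 7 * (1 / 16 * (1 / 16)) := by gcongr
      _ ≤ t ^ 7 * (1 / 32) := by gcongr; norm_num
      _ = _ := by ring
  linarith

theorem indepSum_univ_of_card_eq_one (hn : Fintype.card V = 1) {R : Type*} [CommRing R] (z : R) :
    G.indepSum Finset.univ z = 1 - z := by
  classical
  obtain ⟨v, hv⟩ := Fintype.card_eq_one_iff.1 hn
  have h1 : (Finset.univ.erase v : Finset V) = ∅ := by
    ext x
    simp [hv x]
  have h2 : G.nonNbrs Finset.univ v = ∅ :=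
    Finset.subset_empty.1 (h1 ▸ G.nonNbrs_subset_erase Finset.univ v)
  rw [G.indepSum_eq_erase (Finset.mem_univ v), h1, h2]
  simp

theorem isLeast_smallestRoot {β : ℝ}
    (h : IsLeast {x : ℝ | G.indepSum Finset.univ x = 0} β) :
    G.smallestRoot = β := by
  simp only [smallestRoot, aeval_indepPoly]
  exact h.csInf_eq

end IndepSum

end SimpleGraph

/-- The exponent `O(n)` is `c * n`, with one constant `c` for all connected finite graphs. -/
theorem mainTheorem1 :
    ∃ c : ℕ, ∀ (V : Type u) [Fintype V] (G : SimpleGraph V), G.Connected →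
      IsLeast {x : ℝ | aeval x G.indepPoly = 0} G.smallestRoot ∧
      {z : ℂ | z ∈ Metric.ball (0 : ℂ)
          (G.smallestRoot + (G.smallestRoot / Fintype.card V) ^ (c * Fintype.card V)) ∧
        aeval z G.indepPoly = 0} = {(G.smallestRoot : ℂ)} := by
  refine ⟨11, fun V _ G hG => ?_⟩
  obtain ⟨β, hβ, hleast, hsep⟩ : ∃ β : ℝ, 0 < β ∧
      IsLeast {x : ℝ | G.indepSum Finset.univ x = 0} β ∧
      ∀ z : ℂ, G.indepSum Finset.univ z = 0 → z ≠ β →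
        β + ((β / Fintype.card V) ^ Fintype.card V) ^ 11 ≤ ‖z‖ := by
    have := hG.nonempty
    rcases (Nat.succ_le_of_lt (Fintype.card_pos (α := V))).eq_or_lt with hn | hn
    · have hn : Fintype.card V = 1 := hn.symm
      -- A single vertex has no edge to use, but 1 - z has 1 as its only root.
      refine ⟨1, one_pos, ⟨?_, fun x hx => ?_⟩, fun z hz hne => ?_⟩
      · simp [SimpleGraph.indepSum_univ_of_card_eq_one hn]
      · rw [Set.mem_ofPred_eq, SimpleGraph.indepSum_univ_of_card_eq_one hn] at hx
        linarith
      · rw [SimpleGraph.indepSum_univ_of_card_eq_one hn] at hz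
        exact absurd (sub_eq_zero.1 hz).symm (by simpa using hne)
    · obtain ⟨β, h1, h2, h3, h4⟩ := hG.exists_smallest_root hn
      refine ⟨β, h1, ⟨h3, fun x hx => ?_⟩, fun z hz hne =>
        hG.le_norm_of_root hn h1 h2 h3 h4 hz hne⟩
      by_contra! hlt
      exact (h4 x hlt).ne' hx
  have hpos : 0 < (β / Fintype.card V) ^ (11 * Fintype.card V) := by
    have := hG.nonempty
    have : 0 < Fintype.card V := Fintype.card_pos
    positivity
  rw [SimpleGraph.isLeast_smallestRoot hleast]
  simp only [SimpleGraph.aeval_indepPoly]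
  refine ⟨hleast, ?_⟩
  ext z
  simp only [Set.mem_ofPred_eq, Metric.mem_ball, dist_zero_right, Set.mem_singleton_iff]
  constructor
  · rintro ⟨hz, hz0⟩
    by_contra hne
    have := hsep z hz0 hne
    rw [← pow_mul, mul_comm] at this
    linarith
  · rintro rfl
    refine ⟨?_, ?_⟩
    · rw [Complex.norm_real, Real.norm_of_nonneg hβ.le]
      linarith
    · rw [← SimpleGraph.ofReal_indepSum, hleast.1]
      rfl
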